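/- Let $l_1\ge l_2\ge\cdots\ge l_m\ge 0$ be integers that take exactly three distinct values, and let $Y$ be the Young diagram with left-aligned rows of lengths $l_1,\dots,l_m$ from top to bottom. Suppose that $Y$ is wide: for every diagram $Z$ formed by a subset of the rows of $Y$, $Z$ dominates its conjugate $Z'$, i.e. for every $k\ge 0$ the sum of the lengths of the first $k$ rows of $Z$ is at least the sum of the lengths of the first $k$ columns of $Z$. Then $Y$ is Latin: its cells can be filled with integers so that, for every $i$, the row of length $l_i$ contains exactly the symbols $1,\dots,l_i$ (each once), and no symbol is repeated in a column. -/

import Mathlib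

namespace YoungDiagram

/-- The dominance order on partitions of the same number: `μ` dominates `ν` if they have equally
many cells and, for every `k`, the top `k` rows of `μ` have in total at least as many cells as the
top `k` rows of `ν`. -/
def Dominates (μ ν : YoungDiagram) : Prop :=
  μ.card = ν.card ∧
    ∀ k : ℕ, ∑ i ∈ Finset.range k, ν.rowLen i ≤ ∑ i ∈ Finset.range k, μ.rowLen i

/-- `ν` is (the shape of) a subdiagram formed by a subset of the rows of `μ`: its list of row
lengths is obtained from that of `μ` by deleting entries. -/
def IsRowSubdiagram (ν μ : YoungDiagram) : Prop :=
  ν.rowLens.Sublist μ.rowLens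

/-- A Young diagram is wide if every subdiagram formed by a subset of its rows dominates its
conjugate. -/
def IsWide (μ : YoungDiagram) : Prop :=
  ∀ ν : YoungDiagram, ν.IsRowSubdiagram μ → ν.Dominates ν.transpose

/-- `f` is a Latin filling of `μ` (values of `f` outside `μ` are irrelevant): the row of length `l`
is populated by `1, …, l`, and `f` is injective on each column. As a row of length `l` has `l`
cells, each of `1, …, l` occurs in it exactly once. -/
def IsLatinFilling (μ : YoungDiagram) (f : ℕ × ℕ → ℕ) : Prop :=
  (∀ i, (μ.row i).image f = Finset.Icc 1 (μ.rowLen i)) ∧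
    ∀ j, Set.InjOn f (μ.col j : Set (ℕ × ℕ))

/-- A Young diagram is Latin if it has a Latin filling. -/
def IsLatin (μ : YoungDiagram) : Prop :=
  ∃ f : ℕ × ℕ → ℕ, μ.IsLatinFilling f

end YoungDiagram

/-! Let the lengths be `c + e + g`, `c + e`, `c`, with multiplicities `p`, `q`, `r`. In a Latin
filling, a row of length `l` is a permutation matrix of order `l` in the upper left corner of the
column-symbol square, and the column condition says that these matrices are disjoint
(`isLatin_of_matchings`). As regular bipartite multigraphs split into perfect matchings
(`exists_balanced_decomposition`), it suffices to colour cells of the square so that three disjoint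
colour classes are regular of degrees `p`, `q`, `r` on the corners of orders `c + e + g`, `c + e`,
`c`.

Cut the square into blocks of widths `c, e, g`. Only the number of cells of each colour in each
block matters, since an outline with the right totals can be detached (`exists_detachment`). The
third colour has `r * c` cells in the first block; the second is fixed by its number `t` of cells
there; the first then solves a transportation problem in the remaining capacities
(`exists_transport`). Its nontrivial cuts either do not involve `t`, and follow from domination or
from `p + q + r ≤ c + e + g`, or bound `t` from above. Wideness makes the upper bounds compatible
with the lower ones (`exists_corner_count`). -/

/-! ### Integral transportation, balanced splitting and detachment -/

/-- Integral transportation with capacities: a matrix of natural numbers bounded by `u` with row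
sums `r` and column sums `d` exists as soon as every cut has sufficient capacity. -/
theorem exists_transport {α β : Type*} [Fintype α] [Fintype β] [DecidableEq α] [DecidableEq β]
    (u : α → β → ℕ) (r : α → ℕ) (d : β → ℕ) (hsum : ∑ i, r i = ∑ j, d j)
    (hcut : ∀ (R : Finset α) (C : Finset β),
      ∑ i ∈ R, r i ≤ ∑ i ∈ R, ∑ j ∈ Cᶜ, u i j + ∑ j ∈ C, d j) :
    ∃ x : α → β → ℕ, (∀ i j, x i j ≤ u i j) ∧ (∀ i, ∑ j, x i j = r i) ∧
      ∀ j, ∑ i, x i j = d j := by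
  classical
  have hr : ∀ i, r i ≤ ∑ j, u i j := fun i => by simpa using hcut {i} ∅
  -- Hall's theorem: each unit of capacity at `(i, j)` takes either one of the `∑ j, u i j - r i`
  -- slack slots of row `i` or one of the `d j` demand slots of column `j`. There are as many units
  -- as slots, so a matching fills every slot.
  let t : (Σ ij : α × β, Fin (u ij.1 ij.2)) →
      Finset ((Σ i : α, Fin (∑ j, u i j - r i)) ⊕ (Σ j : β, Fin (d j))) := fun e =>
    (Finset.univ.filter fun y => y.1 = e.1.1).disjSum (Finset.univ.filter fun y => y.1 = e.1.2)
  have cardE : Fintype.card (Σ ij : α × β, Fin (u ij.1 ij.2)) = ∑ i, ∑ j, u i j := by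
    simp [Fintype.card_sigma, Fintype.sum_prod_type]
  have cardW : Fintype.card ((Σ i : α, Fin (∑ j, u i j - r i)) ⊕ (Σ j : β, Fin (d j))) =
      ∑ i, ∑ j, u i j := by
    simp only [Fintype.card_sum, Fintype.card_sigma, Fintype.card_fin]
    rw [← hsum, ← Finset.sum_add_distrib]
    exact Finset.sum_congr rfl fun i _ => Nat.sub_add_cancel (hr i)
  have hall : ∀ s : Finset (Σ ij : α × β, Fin (u ij.1 ij.2)), s.card ≤ (s.biUnion t).card := by
    intro s
    let R := s.image fun e => e.1.1
    let C := s.image fun e => e.1.2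
    have h1 : s.card ≤ ∑ i ∈ R, ∑ j ∈ C, u i j := by
      have : s ⊆ (R ×ˢ C).sigma fun _ => Finset.univ := by
        intro e he
        simp only [Finset.mem_sigma, Finset.mem_product, Finset.mem_univ, and_true]
        exact ⟨Finset.mem_image_of_mem _ he, Finset.mem_image_of_mem _ he⟩
      refine (Finset.card_le_card this).trans ?_
      simp [Finset.card_sigma, Finset.sum_product]
    have h2 : (R.sigma fun _ => Finset.univ).disjSum (C.sigma fun _ => Finset.univ)
        ⊆ s.biUnion t := by
      intro y hy
      rw [Finset.mem_disjSum] at hy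
      rw [Finset.mem_biUnion]
      rcases hy with ⟨z, hz, rfl⟩ | ⟨z, hz, rfl⟩
      · simp only [Finset.mem_sigma, Finset.mem_univ, and_true, R, Finset.mem_image] at hz
        obtain ⟨e, he, h⟩ := hz
        exact ⟨e, he, by simp [t, h]⟩
      · simp only [Finset.mem_sigma, Finset.mem_univ, and_true, C, Finset.mem_image] at hz
        obtain ⟨e, he, h⟩ := hz
        exact ⟨e, he, by simp [t, h]⟩
    refine h1.trans (le_trans ?_ (Finset.card_le_card h2))
    simp only [Finset.card_disjSum, Finset.card_sigma, Finset.card_univ, Fintype.card_fin]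
    have h3 : ∑ i ∈ R, (∑ j, u i j - r i) + ∑ i ∈ R, r i =
        ∑ i ∈ R, ∑ j ∈ C, u i j + ∑ i ∈ R, ∑ j ∈ Cᶜ, u i j := by
      rw [← Finset.sum_add_distrib, ← Finset.sum_add_distrib]
      refine Finset.sum_congr rfl fun i _ => ?_
      rw [Nat.sub_add_cancel (hr i), Finset.sum_add_sum_compl]
    have := hcut R C
    omega
  obtain ⟨f, finj, hf⟩ := (Finset.all_card_le_biUnion_card_iff_exists_injective t).1 hall
  have fbij : Function.Bijective f :=
    (Fintype.bijective_iff_injective_and_card f).2 ⟨finj, by rw [cardE, cardW]⟩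
  let g : β → ((Σ i : α, Fin (∑ j, u i j - r i)) ⊕ (Σ j : β, Fin (d j))) → ℕ :=
    fun j => Sum.elim (fun _ => 0) fun y => if y.1 = j then 1 else 0
  let h : α → ((Σ i : α, Fin (∑ j, u i j - r i)) ⊕ (Σ j : β, Fin (d j))) → ℕ :=
    fun i => Sum.elim (fun y => if y.1 = i then 1 else 0) fun _ => 0
  have hg : ∀ j, ∑ y, g j y = d j := fun j => by
    simp only [g, Fintype.sum_sum_type, Fintype.sum_sigma, Sum.elim_inl, Sum.elim_inr]
    simp [apply_ite Finset.card]
  have hh : ∀ i, ∑ y, h i y = ∑ j, u i j - r i := fun i => by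
    simp only [h, Fintype.sum_sum_type, Fintype.sum_sigma, Sum.elim_inl, Sum.elim_inr]
    simp [apply_ite Finset.card]
  have hf' : ∀ e : (Σ ij : α × β, Fin (u ij.1 ij.2)),
      (∃ k, f e = Sum.inl ⟨e.1.1, k⟩) ∨ ∃ k, f e = Sum.inr ⟨e.1.2, k⟩ := by
    intro e
    have := hf e
    simp only [t, Finset.mem_disjSum, Finset.mem_filter, Finset.mem_univ, true_and] at this
    rcases this with ⟨⟨i, k⟩, rfl, h⟩ | ⟨⟨j, k⟩, rfl, h⟩
    · exact Or.inl ⟨k, h.symm⟩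
    · exact Or.inr ⟨k, h.symm⟩
  have one : ∀ i j m, g j (f ⟨(i, j), m⟩) + h i (f ⟨(i, j), m⟩) = 1 := by
    intro i j m
    rcases hf' ⟨(i, j), m⟩ with ⟨k, hk⟩ | ⟨k, hk⟩ <;> simp [hk, g, h]
  have sumE : ∀ F : (Σ ij : α × β, Fin (u ij.1 ij.2)) → ℕ,
      ∑ e, F e = ∑ i, ∑ j, ∑ m, F ⟨(i, j), m⟩ := fun F => by
    rw [Fintype.sum_sigma, Fintype.sum_prod_type]
  -- The transported amount is the number of units at `(i, j)` matched to demand slots; the others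
  -- account for the slack of the row.
  refine ⟨fun i j => ∑ m, g j (f ⟨(i, j), m⟩), fun i j => ?_, fun i => ?_, fun j => ?_⟩
  · calc ∑ m, g j (f ⟨(i, j), m⟩) ≤ ∑ _m : Fin (u i j), 1 :=
          Finset.sum_le_sum fun m _ => by have := one i j m; omega
      _ = u i j := by simp
  · change ∑ j, ∑ m, g j (f ⟨(i, j), m⟩) = r i
    have e1 : ∑ j, ∑ m, h i (f ⟨(i, j), m⟩) = ∑ j, u i j - r i := by
      rw [← hh i, ← fbij.sum_comp (h i), sumE, Finset.sum_eq_single i]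
      · intro i' _ hne
        refine Finset.sum_eq_zero fun j _ => Finset.sum_eq_zero fun m _ => ?_
        rcases hf' ⟨(i', j), m⟩ with ⟨k, hk⟩ | ⟨k, hk⟩ <;> simp [hk, h, hne]
      · simp
    have e2 : ∑ j, ∑ m, g j (f ⟨(i, j), m⟩) + ∑ j, ∑ m, h i (f ⟨(i, j), m⟩) = ∑ j, u i j := by
      rw [← Finset.sum_add_distrib]
      refine Finset.sum_congr rfl fun j _ => ?_
      rw [← Finset.sum_add_distrib]
      simp [one]
    have := hr i
    omega
  · rw [← hg j, ← fbij.sum_comp (g j), sumE]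
    refine Finset.sum_congr rfl fun i _ => ?_
    rw [Finset.sum_eq_single j]
    · intro j' _ hne
      refine Finset.sum_eq_zero fun m _ => ?_
      rcases hf' ⟨(i, j'), m⟩ with ⟨k, hk⟩ | ⟨k, hk⟩ <;> simp [hk, g, hne]
    · simp

/-- A matrix of natural numbers whose row and column sums are divisible by `n` is a sum of `n`
matrices, each with the row and column sums divided by `n`. -/
theorem exists_balanced_decomposition {α β : Type*} [Fintype α] [Fintype β]
    (ρ : α → ℕ) (σ : β → ℕ) (n : ℕ) (M : α → β → ℕ)
    (hρ : ∀ i, ∑ j, M i j = n * ρ i) (hσ : ∀ j, ∑ i, M i j = n * σ j) :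
    ∃ D : ℕ → α → β → ℕ, (∀ i j, ∑ k ∈ Finset.range n, D k i j = M i j) ∧
      (∀ k < n, ∀ i, ∑ j, D k i j = ρ i) ∧ ∀ k < n, ∀ j, ∑ i, D k i j = σ j := by
  classical
  induction n generalizing M with
  | zero =>
    refine ⟨fun _ _ _ => 0, fun i j => ?_, by simp, by simp⟩
    have h := hρ i
    rw [zero_mul, Finset.sum_eq_zero_iff] at h
    simp [h j (Finset.mem_univ j)]
  | succ n ih =>
    have htot : ∑ i, ρ i = ∑ j, σ j := by
      have h : ∑ i, ∑ j, M i j = ∑ j, ∑ i, M i j := Finset.sum_comm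
      simp only [hρ, hσ, ← Finset.mul_sum] at h
      exact Nat.eq_of_mul_eq_mul_left n.succ_pos h
    -- The fractional matrix `M / (n + 1)` is feasible within the capacities `M`, so the cut
    -- conditions hold and an integral summand can be split off.
    obtain ⟨x, hx, hxr, hxc⟩ := exists_transport M ρ σ htot fun R C => by
      have h1 : (n + 1) * ∑ i ∈ R, ρ i =
          ∑ i ∈ R, ∑ j ∈ C, M i j + ∑ i ∈ R, ∑ j ∈ Cᶜ, M i j := by
        rw [← Finset.sum_add_distrib, Finset.mul_sum]
        exact Finset.sum_congr rfl fun i _ => by rw [Finset.sum_add_sum_compl, hρ]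
      have h2 : ∑ i ∈ R, ∑ j ∈ C, M i j ≤ (n + 1) * ∑ j ∈ C, σ j := by
        rw [Finset.sum_comm, Finset.mul_sum]
        refine Finset.sum_le_sum fun j _ => ?_
        rw [← hσ]
        exact Finset.sum_le_univ_sum_of_nonneg fun _ => Nat.zero_le _
      have h3 : ∑ i ∈ R, ∑ j ∈ Cᶜ, M i j ≤ (n + 1) * ∑ i ∈ R, ∑ j ∈ Cᶜ, M i j :=
        Nat.le_mul_of_pos_left _ n.succ_pos
      refine le_of_mul_le_mul_left (a := n + 1) ?_ n.succ_pos
      rw [mul_add]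
      omega
    obtain ⟨D, hD, hDr, hDc⟩ := ih (fun i j => M i j - x i j)
      (fun i => by
        have h : ∑ j, (M i j - x i j) + ∑ j, x i j = ∑ j, M i j := by
          rw [← Finset.sum_add_distrib]
          exact Finset.sum_congr rfl fun j _ => Nat.sub_add_cancel (hx i j)
        rw [hxr, hρ, add_mul] at h
        omega)
      (fun j => by
        have h : ∑ i, (M i j - x i j) + ∑ i, x i j = ∑ i, M i j := by
          rw [← Finset.sum_add_distrib]
          exact Finset.sum_congr rfl fun i _ => Nat.sub_add_cancel (hx i j)
        rw [hxc, hσ, add_mul] at h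
        omega)
    refine ⟨fun k => if k < n then D k else x, fun i j => ?_, fun k hk i => ?_, fun k hk j => ?_⟩
    · simp only [Finset.sum_range_succ, lt_irrefl, if_false]
      have : ∑ k ∈ Finset.range n, (if k < n then D k else x) i j =
          ∑ k ∈ Finset.range n, D k i j :=
        Finset.sum_congr rfl fun k hk => by rw [if_pos (Finset.mem_range.1 hk)]
      rw [this, hD, Nat.sub_add_cancel (hx i j)]
    · dsimp only
      split_ifs with h
      exacts [hDr k h i, hxr i]
    · dsimp only
      split_ifs with h
      exacts [hDc k h j, hxc j]

/-- `exists_balanced_decomposition` with the summands indexed by a finite type. -/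
theorem exists_balanced_decomposition_fintype {α β γ : Type*} [Fintype α] [Fintype β] [Fintype γ]
    (ρ : α → ℕ) (σ : β → ℕ) (M : α → β → ℕ)
    (hρ : ∀ i, ∑ j, M i j = Fintype.card γ * ρ i) (hσ : ∀ j, ∑ i, M i j = Fintype.card γ * σ j) :
    ∃ D : γ → α → β → ℕ, (∀ i j, ∑ k, D k i j = M i j) ∧
      (∀ k i, ∑ j, D k i j = ρ i) ∧ ∀ k j, ∑ i, D k i j = σ j := by
  obtain ⟨D, hD, hr, hc⟩ := exists_balanced_decomposition ρ σ _ M hρ hσ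
  let e := Fintype.equivFin γ
  refine ⟨fun k => D (e k), fun i j => ?_, fun k => hr _ (e k).2, fun k => hc _ (e k).2⟩
  rw [← hD, Finset.sum_range, ← e.sum_comp]

/-- Detachment of an outline: given the number `N I J x` of cells of colour `x` in each block
`I × J`, where the numbers of cells of each colour in each block row and block column are divisible
by its width, there is a colouring of the cells in which every row and every column has its share
of each colour. -/
theorem exists_detachment {α β I J X : Type*} [Fintype α] [Fintype β] [Fintype I] [Fintype J]
    [Fintype X] [DecidableEq I] [DecidableEq J] (φ : α → I) (ψ : β → J) (N : I → J → X → ℕ)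
    (ρ : I → X → ℕ) (σ : J → X → ℕ)
    (hN : ∀ i j, ∑ x, N i j x =
      Fintype.card {k // φ k = i} * Fintype.card {k // ψ k = j})
    (hρ : ∀ i x, ∑ j, N i j x = Fintype.card {k // φ k = i} * ρ i x)
    (hσ : ∀ j x, ∑ i, N i j x = Fintype.card {k // ψ k = j} * σ j x) :
    ∃ A : α → β → X → ℕ, (∀ k l, ∑ x, A k l x = 1) ∧
      (∀ k x, ∑ l, A k l x = ρ (φ k) x) ∧ ∀ l x, ∑ k, A k l x = σ (ψ l) x := by
  -- Splitting the `J × X` matrix of block row `i` evenly among its rows detaches the rows; `cols`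
  -- then does the same to the `α × X` matrix of each block column.
  have rows : ∀ i, ∃ D : {k // φ k = i} → J → X → ℕ, (∀ j x, ∑ k, D k j x = N i j x) ∧
      (∀ k j, ∑ x, D k j x = Fintype.card {k // ψ k = j}) ∧ ∀ k x, ∑ j, D k j x = ρ i x :=
    fun i => exists_balanced_decomposition_fintype _ _ _ (hN i) (hρ i)
  choose D hD hDr hDc using rows
  have cols : ∀ j, ∃ F : {l // ψ l = j} → α → X → ℕ,
      (∀ k x, ∑ l, F l k x = D (φ k) ⟨k, rfl⟩ j x) ∧
      (∀ l k, ∑ x, F l k x = 1) ∧ ∀ l x, ∑ k, F l k x = σ j x := by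
    refine fun j => exists_balanced_decomposition_fintype _ _ _ (fun k => ?_) fun x => ?_
    · rw [hDr, mul_one]
    · rw [← hσ, ← Fintype.sum_fiberwise φ]
      refine Finset.sum_congr rfl fun i _ => ?_
      rw [← hD]
      refine Finset.sum_congr rfl ?_
      rintro ⟨k, rfl⟩ _
      rfl
  choose F hF hFr hFc using cols
  refine ⟨fun k l x => F (ψ l) ⟨l, rfl⟩ k x, fun k l => hFr _ _ _, fun k x => ?_,
    fun l x => hFc _ _ _⟩
  rw [← hDc (φ k) ⟨k, rfl⟩ x, ← Fintype.sum_fiberwise ψ]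
  refine Finset.sum_congr rfl fun j _ => ?_
  rw [← hF]
  refine Finset.sum_congr rfl ?_
  rintro ⟨l, rfl⟩ _
  rfl

/-! ### The outline on three blocks -/

/-- The number of cells of colour `B` in the first diagonal block can be chosen compatibly with the
capacities and with the cut conditions for colour `A`. -/
theorem exists_corner_count {c e g p q r : ℤ} (hc : 0 ≤ c) (he : 0 ≤ e) (hg : 0 ≤ g)
    (hp : 0 ≤ p) (hq : 0 ≤ q) (hr : 0 ≤ r)
    (h1 : p + q + r ≤ c + e + g) (h2 : q + r ≤ c + e) (h3 : r ≤ c)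
    (hII : p * (c - g) ≤ c * (c + e - q - r))
    (hIII : p * (e - g) ≤ e * (c + e - q))
    (hIV : p * (c - e - g) + q * (c - e) ≤ c * (c - r))
    (hQR : q * (c - e) ≤ c * (c - r)) :
    ∃ t : ℤ, 0 ≤ t ∧ q * (c - e) ≤ t ∧ c * (q - e) ≤ t ∧
      t ≤ q * c ∧ t ≤ c * (c - r) ∧ t ≤ e * e - q * (e - c) ∧
      t ≤ c * (c - r) - p * (c - e - g) ∧
      t ≤ c * (c - r) + c * g - p * (c - e) ∧
      t ≤ c * (c - r) + 2 * c * g + g * g - p * (c + g - e) ∧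
      t ≤ e * e - q * (e - c) - p * (e - c - g) ∧
      t ≤ e * e - q * (e - c) + e * g - p * (e - c) ∧
      t ≤ (e + g) * (e + g) - q * (e - c) - p * (e + g - c) := by
  have hce := mul_nonneg hc he
  have hcg := mul_nonneg hc hg
  have heg := mul_nonneg he hg
  have hpg := mul_nonneg hp hg
  have hpe := mul_nonneg hp he
  have hpc := mul_nonneg hp hc
  have hqg := mul_nonneg hq hg
  have hqe := mul_nonneg hq he
  have hqc := mul_nonneg hq hc
  have hrc := mul_nonneg hr hc
  have hre := mul_nonneg hr he
  have hrg := mul_nonneg hr hg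
  have hcr := mul_nonneg hc (sub_nonneg.2 h3)
  have s1c := mul_nonneg (sub_nonneg.2 h1) hc
  have s1e := mul_nonneg (sub_nonneg.2 h1) he
  have s1g := mul_nonneg (sub_nonneg.2 h1) hg
  have s2c := mul_nonneg (sub_nonneg.2 h2) hc
  have s2e := mul_nonneg (sub_nonneg.2 h2) he
  have s2g := mul_nonneg (sub_nonneg.2 h2) hg
  have hcc := mul_nonneg hc hc
  have hee := mul_nonneg he he
  have hgg := mul_nonneg hg hg
  have hV : (p + q) * (c - e) ≤ c * (c - r) + c * g := by
    rcases le_total c e with h | h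
    · linarith [mul_nonneg hp (sub_nonneg.2 h), mul_nonneg hq (sub_nonneg.2 h)]
    · rcases le_total c (p + q) with h' | h'
      · linarith [mul_nonneg he (sub_nonneg.2 h')]
      · linarith [mul_nonneg hg (sub_nonneg.2 h')]
  have hVI : q * (c - e) ≤ c * (c - r) + 2 * c * g + g * g - p * (c + g - e) := by
    rcases le_total p (c + g) with h | h
    · linarith [mul_nonneg hg (sub_nonneg.2 h)]
    · linarith [mul_nonneg he (sub_nonneg.2 h)]
  have hVII : 0 ≤ e * e - q * (e - c) - p * (e - c - g) := by
    rcases le_total c e with h | h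
    · rcases le_total (c + 2 * e) (2 * p + 2 * q) with h' | h'
      · linarith [mul_nonneg hc (sub_nonneg.2 h')]
      · linarith [mul_nonneg (sub_nonneg.2 h) (sub_nonneg.2 h')]
    · linarith [mul_nonneg hq (sub_nonneg.2 h), mul_nonneg hp (sub_nonneg.2 h)]
  have key : ∀ U : ℤ, 0 ≤ U → q * (c - e) ≤ U → c * (q - e) ≤ U →
      max 0 (max (q * (c - e)) (c * (q - e))) ≤ U :=
    fun U h h' h'' => max_le h (max_le h' h'')
  -- The least value allowed by the three lower bounds; each of the nine upper bounds is compared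
  -- with each of them.
  refine ⟨max 0 (max (q * (c - e)) (c * (q - e))), le_max_left _ _,
    (le_max_left _ _).trans (le_max_right _ _), (le_max_right _ _).trans (le_max_right _ _),
    key _ ?_ ?_ ?_, key _ ?_ ?_ ?_, key _ ?_ ?_ ?_, key _ ?_ ?_ ?_, key _ ?_ ?_ ?_, key _ ?_ ?_ ?_,
    key _ ?_ ?_ ?_, key _ ?_ ?_ ?_, key _ ?_ ?_ ?_⟩
  · linarith
  · linarith
  · linarith
  · linarith
  · linarith
  · linarith
  · rcases le_total c e with h | h
    · linarith [mul_nonneg (sub_nonneg.2 h2) (sub_nonneg.2 h), mul_nonneg hr (sub_nonneg.2 h)]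
    · linarith [mul_nonneg hq (sub_nonneg.2 h)]
  · linarith
  · linarith
  · rcases le_total c e with h | h
    · linarith [mul_nonneg hp (sub_nonneg.2 h)]
    · linarith [mul_nonneg hq (sub_nonneg.2 h)]
  · linarith
  · linarith
  · rcases le_total c e with h | h
    · linarith [mul_nonneg hp (sub_nonneg.2 h)]
    · linarith [mul_nonneg hq (sub_nonneg.2 h)]
  · linarith
  · linarith
  · rcases le_total c e with h | h
    · rcases le_total (c + g) e with h' | h'
      · linarith [mul_nonneg hp (sub_nonneg.2 h')]
      · linarith [mul_nonneg (sub_nonneg.2 h1) (sub_nonneg.2 h'),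
          mul_nonneg hq (sub_nonneg.2 h'), mul_nonneg hr (sub_nonneg.2 h'),
          mul_nonneg hc (sub_nonneg.2 h), mul_nonneg he (sub_nonneg.2 h)]
    · linarith [mul_nonneg hq (sub_nonneg.2 h)]
  · exact hVI
  · rcases le_total g e with h | h
    · linarith [mul_nonneg hp (sub_nonneg.2 h)]
    · linarith [mul_nonneg (sub_nonneg.2 h1) (sub_nonneg.2 h),
        mul_nonneg hq (sub_nonneg.2 h), mul_nonneg hr (sub_nonneg.2 h)]
  · exact hVII
  · rcases le_total c e with h | h
    · linarith [mul_nonneg hq (sub_nonneg.2 h)]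
    · linarith [mul_nonneg hp (sub_nonneg.2 h)]
  · linarith
  · rcases le_total c e with h | h
    · linarith [mul_nonneg (sub_nonneg.2 h1) (sub_nonneg.2 h), mul_nonneg hr (sub_nonneg.2 h)]
    · linarith [mul_nonneg hp (sub_nonneg.2 h), mul_nonneg hq (sub_nonneg.2 h)]
  · rcases le_total c e with h | h
    · linarith [mul_nonneg (sub_nonneg.2 h1) (sub_nonneg.2 h), mul_nonneg hr (sub_nonneg.2 h),
        mul_nonneg hq (sub_nonneg.2 h)]
    · linarith [mul_nonneg hp (sub_nonneg.2 h)]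
  · linarith
  · rcases le_total c (e + g) with h | h
    · linarith [mul_nonneg (sub_nonneg.2 h1) (sub_nonneg.2 h), mul_nonneg hr (sub_nonneg.2 h)]
    · linarith [mul_nonneg hp (sub_nonneg.2 h), mul_nonneg hq (sub_nonneg.2 h)]
  · rcases le_total c (e + g) with h | h
    · linarith [mul_nonneg (sub_nonneg.2 h1) (sub_nonneg.2 h), mul_nonneg hr (sub_nonneg.2 h),
        mul_nonneg hq (sub_nonneg.2 h)]
    · linarith [mul_nonneg hp (sub_nonneg.2 h)]
  · rcases le_total c (e + g) with h | h
    · linarith [mul_nonneg (sub_nonneg.2 h1) (sub_nonneg.2 h), mul_nonneg hr (sub_nonneg.2 h)]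
    · linarith [mul_nonneg hp (sub_nonneg.2 h)]

theorem Fin.sum_finset_three (S : Finset (Fin 3)) (f : Fin 3 → ℕ) :
    ∑ i ∈ S, f i =
      (if 0 ∈ S then f 0 else 0) + (if 1 ∈ S then f 1 else 0) + if 2 ∈ S then f 2 else 0 := by
  rw [← Fin.sum_univ_three fun i => if i ∈ S then f i else 0, Finset.sum_ite_mem,
    Finset.univ_inter]

/-- The number of cells of each colour in a row of the block `i`; the last colour is blank. -/
def blockDegree (c e g p q r : ℕ) : Fin 3 → Fin 4 → ℕ :=
  ![![p, q, r, c + e + g - (p + q + r)], ![p, q, 0, c + e + g - (p + q)],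
    ![p, 0, 0, c + e + g - p]]

set_option maxHeartbeats 1000000 in
/-- The outline of a colouring of the cells of a square, divided into blocks of widths `c, e, g`. -/
theorem exists_outline {c e g p q r : ℕ}
    (h1 : p + q + r ≤ c + e + g) (h2 : q + r ≤ c + e) (h3 : r ≤ c)
    (hI : (p * (c + e - g) : ℤ) ≤ (c + e) * (c + e - q) - r * c)
    (hII : (p * (c - g) : ℤ) ≤ c * (c + e - q - r))
    (hIII : (p * (e - g) : ℤ) ≤ e * (c + e - q))
    (hIV : (p * (c - e - g) + q * (c - e) : ℤ) ≤ c * (c - r))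
    (hQR : (q * (c - e) : ℤ) ≤ c * (c - r)) :
    ∃ N : Fin 3 → Fin 3 → Fin 4 → ℕ,
      (∀ i j, ∑ x, N i j x = ![c, e, g] i * ![c, e, g] j) ∧
      (∀ i x, ∑ j, N i j x = ![c, e, g] i * blockDegree c e g p q r i x) ∧
      ∀ j x, ∑ i, N i j x = ![c, e, g] j * blockDegree c e g p q r j x := by
  obtain ⟨t, t1, t2, t3, t4, t5, t6, t7, t8, t9, t10, t11, t12⟩ := exists_corner_count
    (Int.natCast_nonneg c) (Int.natCast_nonneg e) (Int.natCast_nonneg g) (Int.natCast_nonneg p)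
    (Int.natCast_nonneg q) (Int.natCast_nonneg r) (mod_cast h1) (mod_cast h2) (mod_cast h3)
    hII hIII hIV hQR
  lift t to ℕ using t1
  -- `b` and `b'` count the second colour in the off-diagonal blocks and in the second diagonal
  -- block; `u`, `v`, `w` are the capacities left there for the first colour.
  obtain ⟨b, hb⟩ := Int.eq_ofNat_of_zero_le (sub_nonneg.2 t4)
  obtain ⟨b', hb'⟩ := Int.eq_ofNat_of_zero_le (sub_nonneg.2 t2)
  obtain ⟨u, hu⟩ := Int.eq_ofNat_of_zero_le (sub_nonneg.2 t5)
  obtain ⟨v, hv⟩ := Int.eq_ofNat_of_zero_le (sub_nonneg.2 t3)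
  obtain ⟨w, hw⟩ := Int.eq_ofNat_of_zero_le (sub_nonneg.2 t6)
  have h1' : (p + q + r : ℤ) ≤ c + e + g := mod_cast h1
  have s1c := mul_nonneg (sub_nonneg.2 h1') (Int.natCast_nonneg c)
  have s1e := mul_nonneg (sub_nonneg.2 h1') (Int.natCast_nonneg e)
  have s1g := mul_nonneg (sub_nonneg.2 h1') (Int.natCast_nonneg g)
  have hpc : (0 : ℤ) ≤ p * c := by positivity
  have hpe : (0 : ℤ) ≤ p * e := by positivity
  have hpg : (0 : ℤ) ≤ p * g := by positivity
  have hqc : (0 : ℤ) ≤ q * c := by positivity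
  have hqe : (0 : ℤ) ≤ q * e := by positivity
  have hqg : (0 : ℤ) ≤ q * g := by positivity
  have hrc : (0 : ℤ) ≤ r * c := by positivity
  have hre : (0 : ℤ) ≤ r * e := by positivity
  have hrg : (0 : ℤ) ≤ r * g := by positivity
  have hcg : (0 : ℤ) ≤ c * g := by positivity
  have heg : (0 : ℤ) ≤ e * g := by positivity
  have hce : (0 : ℤ) ≤ c * e := by positivity
  have hgg : (0 : ℤ) ≤ g * g := by positivity
  have hu0 := Int.natCast_nonneg u
  have hv0 := Int.natCast_nonneg v
  have hw0 := Int.natCast_nonneg w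
  have ht0 := Int.natCast_nonneg t
  have hcc : (0 : ℤ) ≤ c * c := by positivity
  have hee : (0 : ℤ) ≤ e * e := by positivity
  -- `hA`, `hB`, `hC` are the cuts whose only row is the last block: they need only `p ≤ c + e + g`.
  have hA : (p * (g - (c + e)) : ℤ) ≤ g * g := by
    rcases le_total (g : ℤ) (c + e) with h | h
    · linarith [mul_nonneg (Int.natCast_nonneg p) (sub_nonneg.2 h)]
    · linarith [mul_nonneg (sub_nonneg.2 h1') (sub_nonneg.2 h),
        mul_nonneg (Int.natCast_nonneg q) (sub_nonneg.2 h),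
        mul_nonneg (Int.natCast_nonneg r) (sub_nonneg.2 h)]
  have hB : (p * (g - e) : ℤ) ≤ g * (g + c) := by
    rcases le_total (g : ℤ) e with h | h
    · linarith [mul_nonneg (Int.natCast_nonneg p) (sub_nonneg.2 h)]
    · linarith [mul_nonneg (sub_nonneg.2 h1') (sub_nonneg.2 h),
        mul_nonneg (Int.natCast_nonneg q) (sub_nonneg.2 h),
        mul_nonneg (Int.natCast_nonneg r) (sub_nonneg.2 h)]
  have hC : (p * (g - c) : ℤ) ≤ g * (g + e) := by
    rcases le_total (g : ℤ) c with h | h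
    · linarith [mul_nonneg (Int.natCast_nonneg p) (sub_nonneg.2 h)]
    · linarith [mul_nonneg (sub_nonneg.2 h1') (sub_nonneg.2 h),
        mul_nonneg (Int.natCast_nonneg q) (sub_nonneg.2 h),
        mul_nonneg (Int.natCast_nonneg r) (sub_nonneg.2 h)]
  obtain ⟨x, hx, hxr, hxc⟩ := exists_transport
    ![![u, v, c * g], ![v, w, e * g], ![c * g, e * g, g * g]]
    ![p * c, p * e, p * g] ![p * c, p * e, p * g] rfl (by
      intro R C
      simp only [Fin.sum_finset_three, Finset.mem_compl]
      by_cases r0 : 0 ∈ R <;> by_cases r1 : 1 ∈ R <;> by_cases r2 : 2 ∈ R <;>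
      by_cases c0 : 0 ∈ C <;> by_cases c1 : 1 ∈ C <;> by_cases c2 : 2 ∈ C <;>
      simp [r0, r1, r2, c0, c1, c2] <;> zify <;> linarith)
  choose y hy using fun i j => Nat.exists_eq_add_of_le (hx i j)
  obtain ⟨d₁, hd₁⟩ := Nat.exists_eq_add_of_le h1
  have e1 : c + e + g - (p + q + r) = d₁ := by omega
  have e2 : c + e + g - (p + q) = r + d₁ := by omega
  have e3 : c + e + g - p = q + r + d₁ := by omega
  zify at hd₁
  have m1 : (c * (c + e + g) : ℤ) = c * (p + q + r + d₁) := by rw [hd₁]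
  have m2 : (e * (c + e + g) : ℤ) = e * (p + q + r + d₁) := by rw [hd₁]
  have m3 : (g * (c + e + g) : ℤ) = g * (p + q + r + d₁) := by rw [hd₁]
  simp only [Fin.forall_fin_succ, Fin.sum_univ_three] at hy hxr hxc
  simp at hy hxr hxc
  zify at hy hxr hxc
  obtain ⟨⟨y1, y2, y3⟩, ⟨y4, y5, y6⟩, y7, y8, y9⟩ := hy
  obtain ⟨x1, x2, x3⟩ := hxr
  obtain ⟨x4, x5, x6⟩ := hxc
  refine ⟨fun i j => ![x i j, (![![t, b, 0], ![b, b', 0], ![0, 0, 0]] : Fin 3 → Fin 3 → ℕ) i j,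
    (![![r * c, 0, 0], ![0, 0, 0], ![0, 0, 0]] : Fin 3 → Fin 3 → ℕ) i j, y i j], ?_, ?_, ?_⟩
  · intro i j
    fin_cases i <;> fin_cases j <;> simp [Fin.sum_univ_succ] <;> zify <;> linarith
  · intro i j
    fin_cases i <;> fin_cases j <;> simp [Fin.sum_univ_succ, blockDegree, e1, e2, e3] <;> zify <;>
      linarith
  · intro i j
    fin_cases i <;> fin_cases j <;> simp [Fin.sum_univ_succ, blockDegree, e1, e2, e3] <;> zify <;>
      linarith

theorem Finset.eq_of_sum_le_one {ι : Type*} {s : Finset ι} {f : ι → ℕ} (h : ∑ i ∈ s, f i ≤ 1)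
    {i j : ι} (hi : i ∈ s) (hj : j ∈ s) (hfi : f i ≠ 0) (hfj : f j ≠ 0) : i = j := by
  classical
  by_contra hne
  have h1 : f i + f j ≤ ∑ k ∈ s, f k := by
    rw [← Finset.sum_pair hne]
    refine Finset.sum_le_sum_of_subset ?_
    intro k hk
    rcases Finset.mem_insert.1 hk with rfl | hk
    · exact hi
    · rwa [Finset.mem_singleton.1 hk]
  omega

/-! ### From the outline to disjoint matchings -/

/-- The index of the block of a row, for blocks of widths `c`, `e` and `g`. -/
def blockIndex (c e g : ℕ) (i : Fin (c + e + g)) : Fin 3 :=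
  if i < c then 0 else if i < c + e then 1 else 2

theorem card_blockIndex (c e g : ℕ) (i : Fin 3) :
    Fintype.card {k // blockIndex c e g k = i} = ![c, e, g] i := by
  have key : ∀ lo hi, hi ≤ c + e + g → (∀ k, blockIndex c e g k = i ↔ lo ≤ (k : ℕ) ∧ k < hi) →
      Fintype.card {k // blockIndex c e g k = i} = hi - lo := by
    intro lo hi hle h
    rw [Fintype.card_subtype, ← Nat.card_Ico, ← Finset.card_map Fin.valEmbedding]
    congr 1
    ext k
    simp only [Finset.mem_map, Finset.mem_filter, Finset.mem_univ, true_and, h, Finset.mem_Ico,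
      Fin.valEmbedding_apply]
    constructor
    · rintro ⟨k, hk, rfl⟩
      exact hk
    · exact fun hk => ⟨⟨k, by omega⟩, hk, rfl⟩
  match i with
  | 0 =>
    rw [key 0 c (by omega) fun k => by unfold blockIndex; split_ifs <;> simp <;> omega]
    simp
  | 1 =>
    rw [key c (c + e) (by omega) fun k => by unfold blockIndex; split_ifs <;> simp <;> omega]
    simp
  | 2 =>
    rw [key (c + e) (c + e + g) (by omega) fun k => by
      unfold blockIndex; split_ifs <;> simp <;> omega]
    simp

/-- Turns block degrees into the form that lets each nonblank colour class be split into partial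
permutation matrices. -/
theorem blockDegree_blockIndex (c e g p q r : ℕ) (k : Fin (c + e + g)) (x : Fin 3) :
    blockDegree c e g p q r (blockIndex c e g k) x.castSucc =
      ![p, q, r] x * if k < ![c + e + g, c + e, c] x then 1 else 0 := by
  have := k.2
  unfold blockIndex blockDegree
  match x with
  | 0 => simp; split_ifs <;> simp
  | 1 =>
    by_cases h : (k : ℕ) < c + e <;> by_cases h' : (k : ℕ) < c <;> simp [h, h']
    omega
  | 2 => by_cases h : (k : ℕ) < c + e <;> by_cases h' : (k : ℕ) < c <;> simp [h, h']

/-- Edge-disjoint partial permutation matrices: `p` of order `c + e + g`, `q` of order `c + e` and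
`r` of order `c`, each in the upper left corner of a square of order `c + e + g`. -/
theorem exists_disjoint_matchings {c e g p q r : ℕ}
    (h1 : p + q + r ≤ c + e + g) (h2 : q + r ≤ c + e) (h3 : r ≤ c)
    (hI : (p * (c + e - g) : ℤ) ≤ (c + e) * (c + e - q) - r * c)
    (hII : (p * (c - g) : ℤ) ≤ c * (c + e - q - r))
    (hIII : (p * (e - g) : ℤ) ≤ e * (c + e - q))
    (hIV : (p * (c - e - g) + q * (c - e) : ℤ) ≤ c * (c - r))
    (hQR : (q * (c - e) : ℤ) ≤ c * (c - r)) :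
    ∃ D : Fin 3 → ℕ → Fin (c + e + g) → Fin (c + e + g) → ℕ,
      (∀ x, ∀ k < ![p, q, r] x, ∀ i, ∑ j, D x k i j =
        if i < ![c + e + g, c + e, c] x then 1 else 0) ∧
      (∀ x, ∀ k < ![p, q, r] x, ∀ j, ∑ i, D x k i j =
        if j < ![c + e + g, c + e, c] x then 1 else 0) ∧
      ∀ i j, ∑ x, ∑ k ∈ Finset.range (![p, q, r] x), D x k i j ≤ 1 := by
  obtain ⟨N, hN, hρ, hσ⟩ := exists_outline h1 h2 h3 hI hII hIII hIV hQR
  obtain ⟨A, hA, hAr, hAc⟩ := exists_detachment (blockIndex c e g) (blockIndex c e g) N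
    (blockDegree c e g p q r) (blockDegree c e g p q r) (by simpa only [card_blockIndex] using hN)
    (by simpa only [card_blockIndex] using hρ) (by simpa only [card_blockIndex] using hσ)
  choose D hD hDr hDc using fun x : Fin 3 => exists_balanced_decomposition
    (fun i : Fin (c + e + g) => if i < ![c + e + g, c + e, c] x then 1 else 0)
    (fun i : Fin (c + e + g) => if i < ![c + e + g, c + e, c] x then 1 else 0)
    (![p, q, r] x) (fun i j => A i j x.castSucc)
    (fun i => by rw [hAr, blockDegree_blockIndex]) (fun i => by rw [hAc, blockDegree_blockIndex])
  refine ⟨D, hDr, hDc, fun i j => ?_⟩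
  simp only [hD]
  rw [← hA i j, Fin.sum_univ_castSucc (n := 3)]
  exact Nat.le_add_right _ _

/-! ### From matchings to Latin fillings -/

namespace YoungDiagram

/-- A Young diagram is Latin if its rows can be assigned edge-disjoint partial permutation matrices
of orders equal to the row lengths. -/
theorem isLatin_of_matchings (μ : YoungDiagram) {a m : ℕ} (ha : ∀ i, μ.rowLen i ≤ a)
    (hm : ∀ i, 0 < μ.rowLen i → i < m) (D : ℕ → Fin a → Fin a → ℕ)
    (hr : ∀ i < m, ∀ j, ∑ s, D i j s = if j < μ.rowLen i then 1 else 0)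
    (hc : ∀ i < m, ∀ s, ∑ j, D i j s = if s < μ.rowLen i then 1 else 0)
    (hD : ∀ j s, ∑ i ∈ Finset.range m, D i j s ≤ 1) : μ.IsLatin := by
  have hex : ∀ i j, ∃ s, j < μ.rowLen i → s < μ.rowLen i ∧
      ∃ (hj : j < a) (hs : s < a), D i ⟨j, hj⟩ ⟨s, hs⟩ ≠ 0 := by
    intro i j
    by_cases hj : j < μ.rowLen i
    · have hja := hj.trans_le (ha i)
      have hi := hm i (by omega)
      have h := hr i hi ⟨j, hja⟩
      rw [if_pos hj] at h
      obtain ⟨s, -, hs⟩ := Finset.exists_ne_zero_of_sum_ne_zero (h.trans_ne one_ne_zero)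
      refine ⟨s, fun _ => ⟨?_, hja, s.2, hs⟩⟩
      by_contra hlt
      have h' := hc i hi s
      rw [if_neg hlt, Finset.sum_eq_zero_iff] at h'
      exact hs (h' _ (Finset.mem_univ _))
    · exact ⟨0, fun h => absurd h hj⟩
  choose f hf using hex
  -- Indices of the square start at `0`, symbols at `1`.
  refine ⟨fun x => f x.1 x.2 + 1, fun i => ?_, fun j => ?_⟩
  · rw [row_eq_prod]
    refine Finset.eq_of_subset_of_card_le ?_ ?_
    · intro y hy
      simp only [Finset.mem_image, Finset.mem_product, Finset.mem_singleton, Finset.mem_range] at hy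
      obtain ⟨⟨i', j⟩, ⟨rfl, hj⟩, rfl⟩ := hy
      have := (hf i' j hj).1
      simp only [Finset.mem_Icc]
      omega
    · rw [Finset.card_image_of_injOn, Finset.card_product]
      · simp
      · rintro ⟨i₁, j₁⟩ h₁ ⟨i₂, j₂⟩ h₂ heq
        simp only [Finset.coe_product, Finset.coe_singleton, Finset.coe_range, Set.mem_prod,
          Set.mem_singleton_iff, Set.mem_Iio] at h₁ h₂
        obtain ⟨rfl : i₁ = i, h₁⟩ := h₁
        obtain ⟨rfl : i₂ = i₁, h₂⟩ := h₂
        obtain ⟨-, k₁, s₁, e₁⟩ := hf i₂ j₁ h₁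
        obtain ⟨-, k₂, s₂, e₂⟩ := hf i₂ j₂ h₂
        have hs : f i₂ j₂ = f i₂ j₁ := by simpa using heq.symm
        simp only [hs] at e₂
        have hsum : ∑ j, D i₂ j ⟨f i₂ j₁, s₁⟩ ≤ 1 := by
          rw [hc i₂ (hm i₂ (by omega))]
          split_ifs <;> simp
        have := Finset.eq_of_sum_le_one hsum (Finset.mem_univ _) (Finset.mem_univ _) e₁ e₂
        simpa using this
  · rintro ⟨i₁, j₁⟩ h₁ ⟨i₂, j₂⟩ h₂ heq
    rw [Finset.mem_coe, mem_col_iff, mem_iff_lt_rowLen] at h₁ h₂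
    obtain ⟨h₁, rfl⟩ := h₁
    obtain ⟨h₂, rfl : j₂ = j₁⟩ := h₂
    obtain ⟨-, k₁, s₁, e₁⟩ := hf i₁ j₂ h₁
    obtain ⟨-, k₂, s₂, e₂⟩ := hf i₂ j₂ h₂
    have hs : f i₂ j₂ = f i₁ j₂ := by simpa using heq.symm
    simp only [hs] at e₂
    have := Finset.eq_of_sum_le_one (hD ⟨j₂, k₁⟩ ⟨f i₁ j₂, s₁⟩)
      (Finset.mem_range.2 (hm i₁ (by omega))) (Finset.mem_range.2 (hm i₂ (by omega))) e₁ e₂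
    rw [this]

end YoungDiagram

/-! ### Diagrams in layered form and their domination inequalities -/

namespace YoungDiagram

theorem sortedGE_replicate_append {a b c : ℕ} (hab : b ≤ a) (hbc : c ≤ b) (p q r : ℕ) :
    (List.replicate p a ++ (List.replicate q b ++ List.replicate r c)).SortedGE := by
  refine List.Pairwise.sortedGE ?_
  simp only [List.pairwise_append, List.pairwise_replicate, List.mem_append, List.mem_replicate]
  grind

theorem mem_ofRowLens_replicate_append {a b c p q r : ℕ} (hab : b ≤ a) (hbc : c ≤ b)
    (hs : (List.replicate p a ++ (List.replicate q b ++ List.replicate r c)).SortedGE) {i j : ℕ} :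
    (i, j) ∈ ofRowLens _ hs ↔
      i < p ∧ j < a ∨ i < p + q ∧ j < b ∨ i < p + q + r ∧ j < c := by
  rw [mem_ofRowLens]
  simp only [List.length_append, List.length_replicate, List.getElem_append, List.getElem_replicate]
  constructor
  · rintro ⟨h, h'⟩
    split_ifs at h' <;> omega
  · intro h
    refine ⟨by omega, ?_⟩
    split_ifs <;> omega

/-- The row lengths of a diagram in layered form: the rows have lengths `c + e + g` (`p` rows),
`c + e` (`q` rows) and `c` (`r` rows). -/
theorem rowLen_replicate_append {c e g p q r : ℕ}
    (hs : (List.replicate p (c + e + g) ++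
      (List.replicate q (c + e) ++ List.replicate r c)).SortedGE) (i : ℕ) :
    (ofRowLens _ hs).rowLen i = (if i < p + q + r then c else 0) + (if i < p + q then e else 0) +
      if i < p then g else 0 := by
  refine eq_of_forall_lt_iff fun j => ?_
  rw [← mem_iff_lt_rowLen, mem_ofRowLens_replicate_append (by omega) (by omega)]
  split_ifs <;> omega

theorem colLen_replicate_append {c e g p q r : ℕ}
    (hs : (List.replicate p (c + e + g) ++
      (List.replicate q (c + e) ++ List.replicate r c)).SortedGE) (j : ℕ) :
    (ofRowLens _ hs).colLen j = (if j < c + e + g then p else 0) + (if j < c + e then q else 0) +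
      if j < c then r else 0 := by
  refine eq_of_forall_lt_iff fun i => ?_
  rw [← mem_iff_lt_colLen, mem_ofRowLens_replicate_append (by omega) (by omega)]
  split_ifs <;> omega

theorem sum_range_ite_lt (k n m : ℕ) :
    ∑ i ∈ Finset.range k, (if i < n then m else 0) = min k n * m := by
  rw [← Finset.sum_filter, Finset.sum_const, smul_eq_mul]
  congr 1
  rw [← Finset.card_range (min k n)]
  congr 1
  ext i
  simp

theorem Dominates.min_le {c e g p q r : ℕ}
    (hs : (List.replicate p (c + e + g) ++
      (List.replicate q (c + e) ++ List.replicate r c)).SortedGE)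
    (h : (ofRowLens _ hs).Dominates (ofRowLens _ hs).transpose) (k : ℕ) :
    min k (c + e + g) * p + min k (c + e) * q + min k c * r ≤
      min k (p + q + r) * c + min k (p + q) * e + min k p * g := by
  simpa only [rowLen_transpose, rowLen_replicate_append, colLen_replicate_append,
    Finset.sum_add_distrib, sum_range_ite_lt] using h.2 k

/-- The inequalities that domination at `k = 1`, `k = c` and `k = c + e` amounts to. -/
theorem Dominates.numeric {c e g p q r : ℕ} (he : 0 < e) (hr : c = 0 → r = 0)
    (hs : (List.replicate p (c + e + g) ++
      (List.replicate q (c + e) ++ List.replicate r c)).SortedGE)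
    (h : (ofRowLens _ hs).Dominates (ofRowLens _ hs).transpose) :
    p + q + r ≤ c + e + g ∧
    (p * (c + e - g) : ℤ) ≤ (c + e) * (c + e - q) - r * c ∧
    (p * (c - g) : ℤ) ≤ c * (c + e - q - r) ∧
    (p * (e - g) : ℤ) ≤ e * (c + e - q) ∧
    (p * (c - e - g) + q * (c - e) : ℤ) ≤ c * (c - r) := by
  have h1 := Dominates.min_le hs h 1
  have hc := Dominates.min_le hs h c
  have hb := Dominates.min_le hs h (c + e)
  have h1r : min 1 c * r = r := by
    rcases Nat.eq_zero_or_pos c with h0 | h0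
    · simp [h0, hr h0]
    · rw [min_eq_left (by omega), one_mul]
  rw [h1r, min_eq_left (by omega), min_eq_left (by omega : 1 ≤ c + e)] at h1
  rw [min_eq_left (by omega), min_eq_left (by omega : c ≤ c + e), min_self] at hc
  rw [min_eq_left (by omega), min_self, min_eq_right (by omega : c ≤ c + e)] at hb
  have a1 := Nat.mul_le_mul_right c (min_le_left 1 (p + q + r))
  have a2 := Nat.mul_le_mul_right e (min_le_left 1 (p + q))
  have a3 := Nat.mul_le_mul_right g (min_le_left 1 p)
  have b1 := Nat.mul_le_mul_right c (min_le_left c (p + q + r))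
  have b2 := Nat.mul_le_mul_right e (min_le_left c (p + q))
  have b2' := Nat.mul_le_mul_right e (min_le_right c (p + q))
  have b3 := Nat.mul_le_mul_right g (min_le_right c p)
  have c1 := Nat.mul_le_mul_right c (min_le_left (c + e) (p + q + r))
  have c2 := Nat.mul_le_mul_right e (min_le_left (c + e) (p + q))
  have c3 := Nat.mul_le_mul_right g (min_le_right (c + e) p)
  -- Each minimum is bounded by one of its arguments; `hII` and `hIV` both come from `k = c` and
  -- differ in the bound for `min c (p + q)`.
  have hI : (c + e) * p + (c + e) * q + c * r ≤ (c + e) * c + (c + e) * e + p * g := by omega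
  have hII : c * p + c * q + c * r ≤ c * c + c * e + p * g := by omega
  have hIV : c * p + c * q + c * r ≤ c * c + (p + q) * e + p * g := by omega
  zify at hI hII hIV
  refine ⟨by omega, by linarith, by linarith, ?_, by linarith⟩
  have hrc : (0 : ℤ) ≤ c * r := by positivity
  have hpg : (0 : ℤ) ≤ p * g := by positivity
  rcases le_total (c + e : ℤ) (p + q) with hpq | hpq
  · linarith [mul_nonneg (Int.natCast_nonneg c) (sub_nonneg.2 hpq)]
  · linarith [mul_nonneg (Int.natCast_nonneg e) (sub_nonneg.2 hpq)]

/-- Wideness enters only through three subdiagrams: the whole, the `q + r` lower rows and the `r`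
lowest rows. The hypotheses `he` and `hr` exclude empty rows, so that `rowLens` returns the given
list. -/
theorem isLatin_replicate_append {c e g p q r : ℕ} (he : 0 < e) (hr : c = 0 → r = 0)
    (hs : (List.replicate p (c + e + g) ++
      (List.replicate q (c + e) ++ List.replicate r c)).SortedGE)
    (hwide : (ofRowLens _ hs).IsWide) : (ofRowLens _ hs).IsLatin := by
  have hpos : ∀ x ∈ List.replicate p (c + e + g) ++
      (List.replicate q (c + e) ++ List.replicate r c), 0 < x := by
    intro x hx
    simp only [List.mem_append, List.mem_replicate] at hx
    omega
  have hdom : ∀ w (hw : w.SortedGE), w.Sublist (List.replicate p (c + e + g) ++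
      (List.replicate q (c + e) ++ List.replicate r c)) →
      (ofRowLens w hw).Dominates (ofRowLens w hw).transpose := by
    intro w hw hsub
    refine hwide _ ?_
    rw [IsRowSubdiagram, rowLens_ofRowLens_eq_self hpos,
      rowLens_ofRowLens_eq_self fun x hx => hpos x (hsub.subset hx)]
    exact hsub
  obtain ⟨h1, hI, hII, hIII, hIV⟩ := Dominates.numeric he hr hs (hdom _ hs (List.Sublist.refl _))
  -- With the `p` longest rows removed, `k = 1` gives `q + r ≤ c + e`, and the last inequality loses
  -- its `p` term.
  obtain ⟨h2, -, -, -, hQR⟩ := Dominates.numeric (g := 0) (p := 0) he hr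
    (sortedGE_replicate_append (by omega) (by omega) _ _ _)
    (hdom _ _ (List.sublist_append_right _ _))
  have h3 := Dominates.min_le (e := 0) (g := 0) (p := 0) (q := 0)
    (sortedGE_replicate_append (by omega) (by omega) _ _ _)
    (hdom _ _ ((List.sublist_append_right _ _).trans (List.sublist_append_right _ _))) 1
  have h3' : r ≤ c := by
    rcases Nat.eq_zero_or_pos c with h0 | h0
    · omega
    · have := Nat.mul_le_mul_right c (min_le_left 1 (0 + 0 + r))
      rw [min_eq_left (by omega : 1 ≤ c)] at h3
      omega
  obtain ⟨D, hDr, hDc, hD⟩ := exists_disjoint_matchings h1 (by omega) h3' hI hII hIII hIV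
    (by simpa using hQR)
  have D0 : ∀ k < p, ∀ i, ∑ j, D 0 k i j = if i < c + e + g then 1 else 0 := hDr 0
  have D1 : ∀ k < q, ∀ i, ∑ j, D 1 k i j = if i < c + e then 1 else 0 := hDr 1
  have D2 : ∀ k < r, ∀ i, ∑ j, D 2 k i j = if i < c then 1 else 0 := hDr 2
  have E0 : ∀ k < p, ∀ i, ∑ j, D 0 k j i = if i < c + e + g then 1 else 0 := hDc 0
  have E1 : ∀ k < q, ∀ i, ∑ j, D 1 k j i = if i < c + e then 1 else 0 := hDc 1
  have E2 : ∀ k < r, ∀ i, ∑ j, D 2 k j i = if i < c then 1 else 0 := hDc 2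
  refine isLatin_of_matchings _ (a := c + e + g) (m := p + q + r) (fun i => ?_) (fun i hi => ?_)
    (fun i => if i < p then D 0 i else if i < p + q then D 1 (i - p) else D 2 (i - (p + q)))
    (fun i hi j => ?_) (fun i hi j => ?_) fun j s => ?_
  · rw [rowLen_replicate_append]
    split_ifs <;> omega
  · rw [rowLen_replicate_append] at hi
    split_ifs at hi <;> omega
  · have hj := j.2
    rw [rowLen_replicate_append, if_pos hi]
    by_cases hp : i < p
    · simp only [hp, hj, show i < p + q by omega, if_true, D0 i hp]
    · by_cases hq : i < p + q
      · simp only [hp, hq, if_true, if_false, add_zero, D1 (i - p) (by omega)]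
      · simp only [hp, hq, if_false, add_zero, D2 (i - (p + q)) (by omega)]
  · have hj := j.2
    rw [rowLen_replicate_append, if_pos hi]
    by_cases hp : i < p
    · simp only [hp, hj, show i < p + q by omega, if_true, E0 i hp]
    · by_cases hq : i < p + q
      · simp only [hp, hq, if_true, if_false, add_zero, E1 (i - p) (by omega)]
      · simp only [hp, hq, if_false, add_zero, E2 (i - (p + q)) (by omega)]
  · refine le_of_eq_of_le ?_ (hD j s)
    rw [Finset.sum_range_add, Finset.sum_range_add, Fin.sum_univ_three]
    refine congrArg₂ _ (congrArg₂ _ ?_ ?_) ?_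
    · exact Finset.sum_congr rfl fun k hk => by
        rw [if_pos (show k < p from Finset.mem_range.1 hk)]
    · refine Finset.sum_congr rfl fun k hk => ?_
      have hk : k < q := Finset.mem_range.1 hk
      rw [if_neg (by omega), if_pos (by omega), Nat.add_sub_cancel_left]
    · refine Finset.sum_congr rfl fun k hk => ?_
      rw [if_neg (by omega), if_neg (by omega), Nat.add_sub_cancel_left]

end YoungDiagram

/-! ### Reduction to layered form -/

theorem List.SortedGE.exists_eq_replicate_append {l : List ℕ} (hl : l.SortedGE)
    (hthree : l.toFinset.card = 3) : ∃ c e g p q r : ℕ, 0 < e ∧ l =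
      List.replicate p (c + e + g) ++ (List.replicate q (c + e) ++ List.replicate r c) := by
  let f := l.toFinset.orderEmbOfFin hthree
  have h01 : f 0 < f 1 := f.strictMono (by decide)
  have h12 : f 1 < f 2 := f.strictMono (by decide)
  have hmem : ∀ x ∈ l, x = f 0 ∨ x = f 1 ∨ x = f 2 := by
    intro x hx
    have hx' : x ∈ Set.range f := by
      rw [Finset.range_orderEmbOfFin]
      simpa using hx
    obtain ⟨i, rfl⟩ := hx'
    match i with
    | 0 => simp
    | 1 => simp
    | 2 => simp
  obtain ⟨e, he⟩ := Nat.exists_eq_add_of_lt h01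
  obtain ⟨g, hg⟩ := Nat.exists_eq_add_of_le h12.le
  refine ⟨f 0, e + 1, g, l.count (f 2), l.count (f 1), l.count (f 0), e.succ_pos, ?_⟩
  rw [← add_assoc, ← he, ← hg]
  refine List.Perm.eq_of_sortedGE hl
    (YoungDiagram.sortedGE_replicate_append h12.le h01.le _ _ _) (List.perm_iff_count.2 fun x => ?_)
  simp only [List.count_append, List.count_replicate, beq_iff_eq]
  by_cases hx : x ∈ l
  · rcases hmem x hx with rfl | rfl | rfl
    · simp [h01.ne', (h01.trans h12).ne']
    · simp [h01.ne, h12.ne']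
    · simp [h12.ne, (h01.trans h12).ne]
  · have h0 := List.count_eq_zero_of_not_mem hx
    have hf : ∀ i, (if f i = x then l.count (f i) else 0) = 0 := fun i => by
      split_ifs with h
      exacts [h ▸ h0, rfl]
    rw [h0, hf, hf, hf]

/-- Here `l` is the list of row lengths from top to bottom; as in a partition written
`0 ≤ l₁ ≤ ⋯ ≤ l_m`, the length `0` is allowed, and every Young diagram arises from such a list. -/
theorem theorem1p1 (l : List ℕ) (hl : l.SortedGE) (hthree : l.toFinset.card = 3)
    (hwide : (YoungDiagram.ofRowLens l hl).IsWide) :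
    (YoungDiagram.ofRowLens l hl).IsLatin := by
  obtain ⟨c, e, g, p, q, r, he, rfl⟩ := hl.exists_eq_replicate_append hthree
  rcases Nat.eq_zero_or_pos c with rfl | hc
  -- If the least value is `0`, its `r` rows are empty and can be dropped without changing the
  -- diagram.
  · have hs := YoungDiagram.sortedGE_replicate_append (a := 0 + e + g) (b := 0 + e) (c := 0)
      (by omega) (by omega) p q 0
    have heq : YoungDiagram.ofRowLens _ hl = YoungDiagram.ofRowLens _ hs := by
      ext ⟨i, j⟩
      rw [YoungDiagram.mem_cells, YoungDiagram.mem_cells,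
        YoungDiagram.mem_ofRowLens_replicate_append (by omega) (by omega),
        YoungDiagram.mem_ofRowLens_replicate_append (by omega) (by omega)]
      omega
    rw [heq] at hwide ⊢
    exact YoungDiagram.isLatin_replicate_append he (fun _ => rfl) hs hwide
  · exact YoungDiagram.isLatin_replicate_append he (fun h => absurd h hc.ne') hl hwide
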